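/- Fix integers $\Delta_C>\Delta_B\ge 2$ with $\Delta_B$ odd. For $n,m\ge 1$ with $n\Delta_B=m\Delta_C$, draw a bipartite Tanner (multi)graph $\mathcal G$ with $n$ bits of degree $\Delta_B$ and $m$ checks of degree $\Delta_C$ from the $(\Delta_B,\Delta_C)$-LDPC ensemble, i.e. match the $n\Delta_B$ edge sockets of the bits with the $m\Delta_C$ edge sockets of the checks by a uniformly random bijection. Let $H\in\mathbb F_2^{m\times n}$ be its adjacency matrix modulo $2$ ($H_{cb}$ is the parity of the number of edges between $c$ and $b$), let $k=\dim\ker H$, and let $\mathcal Q$ be the CSS code on $N=n^2+m^2$ qubits obtained as the hypergraph product of this classical code with itself, with parity-check matrices $$H_X=\left(H\otimes \mathbf 1_n\,\middle|\,\mathbf 1_m\otimes H^{\mathsf T}\right),\qquad H_Z=\left(\mathbf 1_n\otimes H\,\middle|\,H^{\mathsf T}\otimes \mathbf 1_m\right).$$ Let $\mathcal H=-\sum_{S}\prod_{i\in S}X_i-\sum_{S'}\prod_{i\in S'}Z_i$ be its stabilizer Hamiltonian, where $S$ and $S'$ range over the (supports of the) rows of $H_X$ and $H_Z$. Then, with probability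 tending to $1$ as $n\to\infty$ (along those $n$ with $\Delta_C\mid n\Delta_B$), the thermal partition function is $$Z(\beta)=\operatorname{tr}\left(e^{-\beta\mathcal H}\right)=2^{k^2}(2\cosh\beta)^{2n(n-k)}\qquad\text{for all }\beta\in\mathbb R.$$ Consequently there is no thermodynamic phase transition: there is a function $f$, analytic on $0<\beta<\infty$, such that for every $\varepsilon>0$, with probability tending to $1$ as $n\to\infty$, the free energy density satisfies $\left|-\frac{1}{N\beta}\log Z(\beta)-f(\beta)\right|<\varepsilon$ for all $\beta>0$. -/

import Mathlib

open scoped Kronecker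

/-! ### Quantum CSS codes and their Hamiltonians -/

/-- A CSS code with qubits `Q`, `X`-checks `SX` and `Z`-checks `SZ`: two binary parity-check
matrices satisfying the orthogonality condition `H_X H_Zᵀ = 0`. -/
structure CSSCode (Q SX SZ : Type) [Fintype Q] where
  HX : Matrix SX Q (ZMod 2)
  HZ : Matrix SZ Q (ZMod 2)
  orthogonal : HX * HZ.transpose = 0

/-- The Pauli matrix `X` in the computational basis. -/
def pauliX : Matrix (Fin 2) (Fin 2) ℂ := !![0, 1; 1, 0]

/-- The Pauli matrix `Z` in the computational basis. -/
def pauliZ : Matrix (Fin 2) (Fin 2) ℂ := !![1, 0; 0, -1]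

/-- The tensor product `⨂_q A_q` of one-qubit operators, as a matrix on the Hilbert space
`(ℂ²)^{⊗ Q}`, whose computational basis is indexed by `Q → Fin 2`. -/
def qubitTensor {Q : Type} [Fintype Q] (A : Q → Matrix (Fin 2) (Fin 2) ℂ) :
    Matrix (Q → Fin 2) (Q → Fin 2) ℂ :=
  Matrix.of fun x y => ∏ q, A q (x q) (y q)

/-- The Pauli string that acts as `P` on the qubits in the support of `v` and as the identity
on all the others. -/
def pauliString {Q : Type} [Fintype Q] (P : Matrix (Fin 2) (Fin 2) ℂ) (v : Q → ZMod 2) :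
    Matrix (Q → Fin 2) (Q → Fin 2) ℂ :=
  qubitTensor fun q => if v q = 1 then P else 1

namespace CSSCode

variable {Q SX SZ : Type} [Fintype Q] [DecidableEq Q] [Fintype SX] [Fintype SZ]

/-- The stabilizer Hamiltonian: minus the sum of all `X`-checks and all `Z`-checks. -/
def hamiltonian (𝒬 : CSSCode Q SX SZ) : Matrix (Q → Fin 2) (Q → Fin 2) ℂ :=
  -(∑ S, pauliString pauliX (𝒬.HX S)) - ∑ S, pauliString pauliZ (𝒬.HZ S)

/-- The thermal partition function `Z(β) = tr e^{-βℋ}`. -/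
noncomputable def partitionFunction (𝒬 : CSSCode Q SX SZ) (β : ℝ) : ℂ :=
  (NormedSpace.exp (-(β : ℂ) • 𝒬.hamiltonian)).trace

/-- The free energy density `-(1 / (N β)) log Z(β)`, where `N` is the number of qubits. -/
noncomputable def freeEnergyDensity (𝒬 : CSSCode Q SX SZ) (β : ℝ) : ℝ :=
  -(Real.log (𝒬.partitionFunction β).re / (Fintype.card Q * β))

end CSSCode

/-! ### Classical codes and the hypergraph product -/

/-- The number `k` of logical bits of the code with parity-check matrix `H`. -/
noncomputable def logicalBits {m n : ℕ} (H : Matrix (Fin m) (Fin n) (ZMod 2)) : ℕ :=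
  Module.finrank (ZMod 2) (LinearMap.ker H.mulVecLin)

/-- The hypergraph product of a classical code with itself:
`H_X = (H ⊗ 1_n | 1_m ⊗ Hᵀ)` and `H_Z = (1_n ⊗ H | Hᵀ ⊗ 1_m)`. -/
def hypergraphProduct {m n : ℕ} (H : Matrix (Fin m) (Fin n) (ZMod 2)) :
    CSSCode ((Fin n × Fin n) ⊕ (Fin m × Fin m)) (Fin m × Fin n) (Fin n × Fin m) where
  HX := Matrix.fromCols (H ⊗ₖ (1 : Matrix (Fin n) (Fin n) (ZMod 2)))
    ((1 : Matrix (Fin m) (Fin m) (ZMod 2)) ⊗ₖ H.transpose)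
  HZ := Matrix.fromCols ((1 : Matrix (Fin n) (Fin n) (ZMod 2)) ⊗ₖ H)
    (H.transpose ⊗ₖ (1 : Matrix (Fin m) (Fin m) (ZMod 2)))
  orthogonal := by
    rw [Matrix.transpose_fromCols, Matrix.fromCols_mul_fromRows, ← Matrix.kroneckerMap_transpose,
      ← Matrix.kroneckerMap_transpose, ← Matrix.mul_kronecker_mul, ← Matrix.mul_kronecker_mul]
    simp only [Matrix.transpose_one, Matrix.transpose_transpose, Matrix.mul_one, Matrix.one_mul]
    ext i j
    exact CharTwo.add_self_eq_zero _

/-! ### The random LDPC ensemble -/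

/-- An element of the `(ΔB, ΔC)`-LDPC ensemble with `n` bits and `m` checks. Each bit has `ΔB`
sockets, each check has `ΔC` sockets, and the edges of the Tanner graph match the sockets of the
bits one-to-one with the sockets of the checks. So every bit has degree `ΔB` and every check has
degree `ΔC`, counted with multiplicity. -/
abbrev TannerGraph (ΔB ΔC n m : ℕ) : Type := (Fin n × Fin ΔB) ≃ (Fin m × Fin ΔC)

/-- The parity-check matrix: the bipartite adjacency matrix of the Tanner graph over `𝔽₂`; the
entry at `(c, b)` is the number of edges joining `b` to `c`, modulo `2`. -/
def TannerGraph.parityCheck {ΔB ΔC n m : ℕ} (G : TannerGraph ΔB ΔC n m) :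
    Matrix (Fin m) (Fin n) (ZMod 2) :=
  Matrix.of fun c b => ((Finset.univ.filter fun i : Fin ΔB => (G (b, i)).1 = c).card : ZMod 2)

/-- The probability of an event when the Tanner graph is drawn uniformly from the ensemble. -/
noncomputable def ensembleProb {ΔB ΔC n m : ℕ} (E : Set (TannerGraph ΔB ΔC n m)) : ℝ :=
  (Nat.card E : ℝ) / Nat.card (TannerGraph ΔB ΔC n m)

/-- The event `E` has probability tending to `1` as `n → ∞`, where `n` runs through the lengths
for which the ensemble exists, i.e. `n ΔB = m ΔC` for some number `m` of checks. -/
def WithHighProbability (ΔB ΔC : ℕ) (E : ∀ n m : ℕ, TannerGraph ΔB ΔC n m → Prop) : Prop :=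
  ∀ ε : ℝ, 0 < ε → ∃ n₀ : ℕ, ∀ n m : ℕ, n₀ ≤ n → n * ΔB = m * ΔC →
    1 - ε ≤ ensembleProb {G | E n m G}

/-- The self-hypergraph-product codes of the random `(ΔB, ΔC)`-LDPC ensemble have no thermodynamic
phase transition: their free energy density converges in probability as `n → ∞` (uniformly in
the inverse temperature) to a function that is analytic on `0 < β < ∞`. -/
def NoThermodynamicPhaseTransition (ΔB ΔC : ℕ) : Prop :=
  ∃ f : ℝ → ℝ, AnalyticOnNhd ℝ f (Set.Ioi 0) ∧
    ∀ ε : ℝ, 0 < ε → WithHighProbability ΔB ΔC fun _ _ G =>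
      ∀ β : ℝ, 0 < β →
        |(hypergraphProduct G.parityCheck).freeEnergyDensity β - f β| < ε

/-!
In a code with independent checks, a nonempty product of distinct checks is never a multiple of the
identity, and every nontrivial Pauli string is traceless. Expanding
`e^{-βℋ} = ∏ (cosh β + S sinh β)` over the checks `S`, only the leading term has a trace
(`CSSCode.partitionFunction_of_linearIndependent`), so that `Z(β) = 2^N (cosh β)^{#checks}`: the
checks behave like free spins. The checks of a hypergraph product are independent as soon as the
rows of `H` are. Then `k = n - m`, and the free energy density depends on `β` and on the ratio
`m / n = ΔB / ΔC` alone, so that its limit is attained exactly at every length.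

It remains to see that the rows of the random matrix `H` are independent with high probability
(`withHighProbability_linearIndependent`). A dependency is a set of `w ≥ 1` checks that every bit
joins by an even number of edges. Its `a = w ΔC` sockets are matched to a uniformly random `a`-set
of bit sockets, so the expected number of dependencies of weight `w` is
`C(m, w) e(a) / C(n ΔB, a)`, where `e(a)` counts the `a`-sets of bit sockets that meet each bit
evenly. Such a set is determined by all of its `ΔB` columns but one, and averaging over the omitted
column yields `e(a) ≤ (n + 1)^ΔB C(n ΔB, a)^{1 - 1/ΔB}` (`card_evenSets_pow_le`). On the other
hand `C(m, w)^ΔC ≤ C(m ΔC, w ΔC) = C(n ΔB, a)`. Together, the expectation is at most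
`(n + 1)^ΔB C(n ΔB, a)^{1/ΔC - 1/ΔB}`, whose exponent is negative because `ΔB < ΔC`. The binomial
coefficient exceeds any given power of `n` once `w` exceeds a constant: since `ΔB` is odd, an even
set misses a socket of every bit, which keeps `a` away from `n ΔB` as well. The boundedly many
remaining weights contribute `O(n^{w - a/2})` each, and `a ≥ 4 w`.
-/

/-! ### Tensor products and Pauli strings -/

section PauliStrings

lemma ZMod.two_eq_zero_or_eq_one (a : ZMod 2) : a = 0 ∨ a = 1 := by
  revert a; decide

lemma qubitTensor_smul {Q : Type} [Fintype Q] (c : Q → ℂ) (A : Q → Matrix (Fin 2) (Fin 2) ℂ) :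
    qubitTensor (fun q => c q • A q) = (∏ q, c q) • qubitTensor A := by
  ext x y
  simp [qubitTensor, Finset.prod_mul_distrib]

lemma qubitTensor_one {Q : Type} [Fintype Q] :
    qubitTensor (fun _ : Q => (1 : Matrix (Fin 2) (Fin 2) ℂ)) = 1 := by
  ext x y
  simp only [qubitTensor, Matrix.of_apply, Matrix.one_apply]
  split_ifs with h
  · simp [h]
  · obtain ⟨q, hq⟩ := Function.ne_iff.1 h
    exact Finset.prod_eq_zero (Finset.mem_univ q) (if_neg hq)

lemma prod_sign_eq_sign_sum {Q : Type} (f : Q → ZMod 2) (s : Finset Q) :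
    ∏ q ∈ s, (if f q = 1 then (-1 : ℂ) else 1) = if ∑ q ∈ s, f q = 1 then -1 else 1 := by
  classical
  induction s using Finset.induction_on with
  | empty => simp
  | insert q s hq ih =>
    rw [Finset.prod_insert hq, Finset.sum_insert hq, ih]
    rcases (f q).two_eq_zero_or_eq_one with ha | ha <;>
      rcases (∑ q ∈ s, f q).two_eq_zero_or_eq_one with hb | hb <;>
      simp [ha, hb, CharTwo.add_self_eq_zero]

variable {Q : Type} [Fintype Q] [DecidableEq Q]

lemma qubitTensor_mul (A B : Q → Matrix (Fin 2) (Fin 2) ℂ) :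
    qubitTensor A * qubitTensor B = qubitTensor fun q => A q * B q := by
  ext x y
  simp only [qubitTensor, Matrix.mul_apply, Matrix.of_apply, ← Finset.prod_mul_distrib]
  rw [Finset.prod_univ_sum, Fintype.piFinset_univ]

lemma trace_qubitTensor (A : Q → Matrix (Fin 2) (Fin 2) ℂ) :
    (qubitTensor A).trace = ∏ q, (A q).trace := by
  simp only [Matrix.trace, Matrix.diag_apply, qubitTensor, Matrix.of_apply]
  rw [Finset.prod_univ_sum, Fintype.piFinset_univ]

lemma pauliX_mul_self : pauliX * pauliX = 1 := by
  ext i j; fin_cases i <;> fin_cases j <;> simp [pauliX, Matrix.mul_apply]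

lemma pauliZ_mul_self : pauliZ * pauliZ = 1 := by
  ext i j; fin_cases i <;> fin_cases j <;> simp [pauliZ, Matrix.mul_apply]

lemma pauliX_mul_pauliZ : pauliX * pauliZ = (-1 : ℂ) • (pauliZ * pauliX) := by
  ext i j; fin_cases i <;> fin_cases j <;> simp [pauliX, pauliZ, Matrix.mul_apply]

lemma pauliString_zero {Q : Type} [Fintype Q] (P : Matrix (Fin 2) (Fin 2) ℂ) :
    pauliString P (0 : Q → ZMod 2) = 1 := by
  simp [pauliString, qubitTensor_one]

/-- For an involution `P`, the Pauli strings form a representation of `𝔽₂^Q`. -/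
lemma pauliString_mul {P : Matrix (Fin 2) (Fin 2) ℂ} (hP : P * P = 1) (u v : Q → ZMod 2) :
    pauliString P u * pauliString P v = pauliString P (u + v) := by
  rw [pauliString, pauliString, pauliString, qubitTensor_mul]
  congr 1
  ext1 q
  rw [Pi.add_apply]
  rcases (u q).two_eq_zero_or_eq_one with hu | hu <;>
    rcases (v q).two_eq_zero_or_eq_one with hv | hv <;> simp [hu, hv, hP, CharTwo.add_self_eq_zero]

lemma pauliString_mul_self {P : Matrix (Fin 2) (Fin 2) ℂ} (hP : P * P = 1) (u : Q → ZMod 2) :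
    pauliString P u * pauliString P u = 1 := by
  rw [pauliString_mul hP, show u + u = 0 from funext fun q => CharTwo.add_self_eq_zero _,
    pauliString_zero]

/-- Two strings of opposite type commute as soon as their supports overlap evenly. -/
lemma commute_pauliString {u v : Q → ZMod 2} (h : ∑ q, u q * v q = 0) :
    Commute (pauliString pauliX u) (pauliString pauliZ v) := by
  have hq : (fun q => (if u q = 1 then pauliX else 1) * (if v q = 1 then pauliZ else 1)) =
      fun q => (if u q * v q = 1 then (-1 : ℂ) else 1) •
        ((if v q = 1 then pauliZ else 1) * (if u q = 1 then pauliX else 1)) := by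
    ext1 q
    rcases (u q).two_eq_zero_or_eq_one with hu | hu <;>
      rcases (v q).two_eq_zero_or_eq_one with hv | hv <;> simp [hu, hv, pauliX_mul_pauliZ]
  rw [Commute, SemiconjBy, pauliString, pauliString, qubitTensor_mul, qubitTensor_mul, hq,
    qubitTensor_smul, prod_sign_eq_sign_sum, h]
  simp

/-- Distinct products of an `X`-string and a `Z`-string are orthogonal in the trace form, so only
the identity contributes to a trace. -/
lemma trace_pauliString_mul (u v : Q → ZMod 2) :
    (pauliString pauliX u * pauliString pauliZ v).trace =
      if u = 0 ∧ v = 0 then 2 ^ Fintype.card Q else 0 := by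
  rw [pauliString, pauliString, qubitTensor_mul, trace_qubitTensor]
  split_ifs with h
  · simp [h.1, h.2, Finset.card_univ]
  · obtain ⟨q, hq⟩ : ∃ q, ¬ (u q = 0 ∧ v q = 0) := by
      by_contra! H
      exact h ⟨funext fun q => (H q).1, funext fun q => (H q).2⟩
    refine Finset.prod_eq_zero (Finset.mem_univ q) ?_
    rcases (u q).two_eq_zero_or_eq_one with hu | hu <;>
      rcases (v q).two_eq_zero_or_eq_one with hv | hv <;>
      simp [hu, hv, pauliX, pauliZ, Matrix.trace] at hq ⊢

end PauliStrings

/-! ### The partition function of a code with independent checks -/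

section PartitionFunction

lemma NormedSpace.exp_smul_of_mul_self_eq_one {A : Type*} [NormedRing A] [NormedAlgebra ℂ A]
    [CompleteSpace A] {S : A} (hS : S * S = 1) (z : ℂ) :
    NormedSpace.exp (z • S) = Complex.cosh z • (1 : A) + Complex.sinh z • S := by
  have hpow : ∀ k : ℕ, S ^ (2 * k) = 1 := fun k => by rw [pow_mul, sq, hS, one_pow]
  have h := NormedSpace.exp_series_hasSum_exp' (𝕂 := ℂ) (z • S)
  refine h.unique (HasSum.even_add_odd ?_ ?_)
  · convert (Complex.hasSum_cosh z).smul_const (1 : A) using 2 with k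
    rw [smul_pow, hpow, smul_smul, div_eq_inv_mul]
  · convert (Complex.hasSum_sinh z).smul_const S using 2 with k
    rw [smul_pow, pow_succ S, hpow, one_mul, smul_smul, div_eq_inv_mul]

lemma Matrix.exp_smul_of_mul_self_eq_one {I : Type} [Fintype I] [DecidableEq I] {S : Matrix I I ℂ}
    (hS : S * S = 1) (z : ℂ) :
    NormedSpace.exp (z • S) = Complex.cosh z • (1 : Matrix I I ℂ) + Complex.sinh z • S := by
  let _ : NormedRing (Matrix I I ℂ) := Matrix.linftyOpNormedRing
  let _ : NormedAlgebra ℂ (Matrix I I ℂ) := Matrix.linftyOpNormedAlgebra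
  exact NormedSpace.exp_smul_of_mul_self_eq_one hS z

variable {Q : Type} [Fintype Q] [DecidableEq Q]

/-- High-temperature expansion of the Boltzmann weight of a family of Pauli strings of one type. -/
lemma exp_smul_sum_pauliString {P : Matrix (Fin 2) (Fin 2) ℂ} (hP : P * P = 1) {I : Type}
    (u : I → Q → ZMod 2) (z : ℂ) (s : Finset I) :
    NormedSpace.exp (z • ∑ i ∈ s, pauliString P (u i)) =
      ∑ t ∈ s.powerset, (Complex.sinh z ^ t.card * Complex.cosh z ^ (s.card - t.card)) •
        pauliString P (∑ i ∈ t, u i) := by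
  classical
  induction s using Finset.induction_on with
  | empty => simp [pauliString_zero]
  | insert a s ha ih =>
    have hcomm : Commute (z • pauliString P (u a)) (z • ∑ i ∈ s, pauliString P (u i)) := by
      refine (Commute.smul_left ?_ _).smul_right _
      refine Commute.sum_right _ _ _ fun i _ => ?_
      rw [Commute, SemiconjBy, pauliString_mul hP, pauliString_mul hP, add_comm]
    rw [Finset.sum_insert ha, smul_add, Matrix.exp_add_of_commute _ _ hcomm, ih,
      Matrix.exp_smul_of_mul_self_eq_one (pauliString_mul_self hP _), Finset.sum_powerset_insert ha,
      add_mul, Finset.mul_sum, Finset.mul_sum]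
    congr 1 <;> refine Finset.sum_congr rfl fun t ht => ?_
    · have hle := Finset.card_le_card (Finset.mem_powerset.1 ht)
      rw [smul_mul_smul_comm, one_mul, Finset.card_insert_of_notMem ha, Nat.sub_add_comm hle]
      congr 1
      ring
    · have hat : a ∉ t := fun h => ha (Finset.mem_powerset.1 ht h)
      rw [smul_mul_smul_comm, pauliString_mul hP, Finset.card_insert_of_notMem ha,
        Finset.card_insert_of_notMem hat, Finset.sum_insert hat, Nat.add_sub_add_right]
      congr 1
      ring

lemma LinearIndependent.sum_eq_zero_iff_of_zmod_two {I M : Type} [AddCommGroup M]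
    [Module (ZMod 2) M] {u : I → M} (hu : LinearIndependent (ZMod 2) u) (t : Finset I) :
    ∑ i ∈ t, u i = 0 ↔ t = ∅ := by
  refine ⟨fun h => Finset.eq_empty_of_forall_notMem fun i hi => ?_, fun h => by simp [h]⟩
  exact one_ne_zero (linearIndependent_iff'.1 hu t (fun _ => 1) (by simpa using h) i hi)

/-- If the checks of a stabilizer code are independent, every nontrivial product of checks is a
nontrivial Pauli string, hence traceless, and only the leading term of the high-temperature
expansion survives. -/
theorem CSSCode.partitionFunction_of_linearIndependent {SX SZ : Type} [Fintype SX] [Fintype SZ]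
    (𝒬 : CSSCode Q SX SZ) (hX : LinearIndependent (ZMod 2) 𝒬.HX.row)
    (hZ : LinearIndependent (ZMod 2) 𝒬.HZ.row) (β : ℝ) :
    𝒬.partitionFunction β =
      2 ^ Fintype.card Q * (Real.cosh β : ℂ) ^ (Fintype.card SX + Fintype.card SZ) := by
  have hham : -(β : ℂ) • 𝒬.hamiltonian =
      (β : ℂ) • ∑ S, pauliString pauliX (𝒬.HX.row S) +
        (β : ℂ) • ∑ S, pauliString pauliZ (𝒬.HZ.row S) := by
    rw [hamiltonian, ← smul_add, neg_smul, ← smul_neg]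
    congr 1
    rw [neg_sub, sub_neg_eq_add, add_comm]
    rfl
  have hcomm : Commute ((β : ℂ) • ∑ S, pauliString pauliX (𝒬.HX.row S))
      ((β : ℂ) • ∑ S, pauliString pauliZ (𝒬.HZ.row S)) := by
    refine (Commute.smul_left ?_ _).smul_right _
    refine Commute.sum_left _ _ _ fun S _ => Commute.sum_right _ _ _ fun S' _ => ?_
    exact commute_pauliString (congrFun (congrFun 𝒬.orthogonal S) S')
  rw [partitionFunction, hham, Matrix.exp_add_of_commute _ _ hcomm,
    exp_smul_sum_pauliString pauliX_mul_self, exp_smul_sum_pauliString pauliZ_mul_self,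
    Finset.sum_mul_sum, Matrix.trace_sum, Finset.sum_eq_single ∅, Matrix.trace_sum,
    Finset.sum_eq_single ∅]
  · rw [smul_mul_smul_comm, Matrix.trace_smul, trace_pauliString_mul]
    simp only [Finset.sum_empty, Finset.card_empty, Finset.card_univ]
    simp [pow_add]
    ring
  · intro t _ ht
    have := (hZ.sum_eq_zero_iff_of_zmod_two t).not.2 ht
    rw [smul_mul_smul_comm, Matrix.trace_smul, trace_pauliString_mul, if_neg, smul_zero]
    exact fun h => this h.2
  · simp
  · intro t _ ht
    have := (hX.sum_eq_zero_iff_of_zmod_two t).not.2 ht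
    rw [Matrix.trace_sum]
    refine Finset.sum_eq_zero fun t' _ => ?_
    rw [smul_mul_smul_comm, Matrix.trace_smul, trace_pauliString_mul, if_neg, smul_zero]
    exact fun h => this h.1
  · simp

end PartitionFunction

/-! ### Hypergraph products of codes with independent checks -/

section HypergraphProduct

variable {m n : ℕ} {H : Matrix (Fin m) (Fin n) (ZMod 2)}

lemma linearIndependent_row_iff_vecMul {I J : Type} [Fintype I] {M : Matrix I J (ZMod 2)} :
    LinearIndependent (ZMod 2) M.row ↔ ∀ x, Matrix.vecMul x M = 0 → x = 0 := by
  rw [← Matrix.vecMul_injective_iff]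
  exact injective_iff_map_eq_zero M.vecMulLinear

lemma linearIndependent_hypergraphProduct_HX (hH : LinearIndependent (ZMod 2) H.row) :
    LinearIndependent (ZMod 2) (hypergraphProduct H).HX.row := by
  rw [linearIndependent_row_iff_vecMul] at hH ⊢
  intro x hx
  ext ⟨c, b⟩
  refine congrFun (hH (fun c => x (c, b)) ?_) c
  ext b'
  have := congrFun hx (Sum.inl (b', b))
  simpa [hypergraphProduct, Matrix.vecMul, dotProduct, Fintype.sum_prod_type,
    Matrix.one_apply] using this

lemma linearIndependent_hypergraphProduct_HZ (hH : LinearIndependent (ZMod 2) H.row) :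
    LinearIndependent (ZMod 2) (hypergraphProduct H).HZ.row := by
  rw [linearIndependent_row_iff_vecMul] at hH ⊢
  intro x hx
  ext ⟨b, c⟩
  refine congrFun (hH (fun c => x (b, c)) ?_) c
  ext b'
  have := congrFun hx (Sum.inl (b, b'))
  simpa [hypergraphProduct, Matrix.vecMul, dotProduct, Fintype.sum_prod_type_right,
    Matrix.one_apply] using this

lemma logicalBits_add_of_linearIndependent (hH : LinearIndependent (ZMod 2) H.row) :
    logicalBits H + m = n := by
  have h := H.mulVecLin.finrank_range_add_finrank_ker
  have hr : Module.finrank (ZMod 2) (LinearMap.range H.mulVecLin) = m := by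
    simpa [Matrix.rank] using hH.rank_matrix
  rw [hr, Module.finrank_fin_fun] at h
  rw [logicalBits]
  omega

lemma partitionFunction_hypergraphProduct (hH : LinearIndependent (ZMod 2) H.row) (β : ℝ) :
    (hypergraphProduct H).partitionFunction β =
      2 ^ (n * n + m * m) * (Real.cosh β : ℂ) ^ (2 * n * m) := by
  rw [CSSCode.partitionFunction_of_linearIndependent _
    (linearIndependent_hypergraphProduct_HX hH) (linearIndependent_hypergraphProduct_HZ hH)]
  simp only [Fintype.card_sum, Fintype.card_prod, Fintype.card_fin]
  congr 2
  ring

lemma partitionFunction_hypergraphProduct_eq_logicalBits (hH : LinearIndependent (ZMod 2) H.row)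
    (β : ℝ) :
    (hypergraphProduct H).partitionFunction β =
      (2 : ℂ) ^ (logicalBits H ^ 2) *
        ((2 * Real.cosh β : ℝ) : ℂ) ^ (2 * n * (n - logicalBits H)) := by
  have hk := logicalBits_add_of_linearIndependent hH
  have hm : n - logicalBits H = m := by omega
  rw [partitionFunction_hypergraphProduct hH, hm, Complex.ofReal_mul, mul_pow, ← mul_assoc,
    Complex.ofReal_ofNat, ← pow_add]
  congr 2
  generalize logicalBits H = k at hk
  subst hk
  ring

/-- The free energy density depends only on the ratio `m / n`, which is constant along an
ensemble. -/
lemma freeEnergyDensity_hypergraphProduct (hH : LinearIndependent (ZMod 2) H.row) {ΔB ΔC : ℕ}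
    (hn : 0 < n) (hC : 0 < ΔC) (hnm : n * ΔB = m * ΔC) (β : ℝ) :
    (hypergraphProduct H).freeEnergyDensity β =
      -((Real.log 2 + 2 * ΔB * ΔC / (ΔB ^ 2 + ΔC ^ 2) * Real.log (Real.cosh β)) / β) := by
  have hcosh := Real.cosh_pos β
  have hre : ((hypergraphProduct H).partitionFunction β).re =
      2 ^ (n * n + m * m) * Real.cosh β ^ (2 * n * m) := by
    rw [partitionFunction_hypergraphProduct hH]
    exact_mod_cast Complex.ofReal_re (2 ^ (n * n + m * m) * Real.cosh β ^ (2 * n * m))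
  rw [CSSCode.freeEnergyDensity, hre, Real.log_mul (by positivity) (by positivity), Real.log_pow,
    Real.log_pow, ← div_div]
  simp only [Fintype.card_sum, Fintype.card_prod, Fintype.card_fin]
  have hn' : (0 : ℝ) < n := by exact_mod_cast hn
  have hC' : (0 : ℝ) < ΔC := by exact_mod_cast hC
  have hm : (m : ℝ) = n * ΔB / ΔC := by
    rw [eq_div_iff hC'.ne']
    exact_mod_cast hnm.symm
  congr 2
  push_cast
  rw [hm]
  field_simp
  ring

end HypergraphProduct

/-! ### Subsets of a grid meeting every row evenly -/

section EvenSets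

open Finset

/-- The `a`-element sets of bit sockets that contain an even number of sockets of every bit. -/
def evenSets (n d a : ℕ) : Finset (Finset (Fin n × Fin d)) :=
  {A ∈ powersetCard a univ | ∀ b, Even #{i | (b, i) ∈ A}}

variable {n d a : ℕ}

lemma mem_evenSets {A : Finset (Fin n × Fin d)} :
    A ∈ evenSets n d a ↔ #A = a ∧ ∀ b, Even #{i | (b, i) ∈ A} := by
  simp [evenSets]

lemma card_eq_sum_card_row (A : Finset (Fin n × Fin d)) : #A = ∑ b, #{i | (b, i) ∈ A} := by
  simp_rw [card_filter]
  rw [← Fintype.sum_prod_type' fun b i => if (b, i) ∈ A then 1 else 0]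
  simp

lemma card_eq_sum_card_column (A : Finset (Fin n × Fin d)) : #A = ∑ i, #{b | (b, i) ∈ A} := by
  simp_rw [card_filter]
  rw [← Fintype.sum_prod_type_right' fun b i => if (b, i) ∈ A then 1 else 0]
  simp

lemma prod_choose_le {I : Type*} (s : Finset I) (N t : I → ℕ) :
    ∏ i ∈ s, (N i).choose (t i) ≤ (∑ i ∈ s, N i).choose (∑ i ∈ s, t i) := by
  classical
  induction s using Finset.induction_on with
  | empty => simp
  | insert i s hi ih =>
    rw [prod_insert hi, sum_insert hi, sum_insert hi, Nat.add_choose_eq]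
    refine (Nat.mul_le_mul_left _ ih).trans ?_
    exact single_le_sum (f := fun ij : ℕ × ℕ => (N i).choose ij.1 * (∑ i ∈ s, N i).choose ij.2)
      (fun _ _ => Nat.zero_le _) (mem_antidiagonal.2 (rfl : (t i, ∑ i ∈ s, t i).1 + _ = _))

lemma choose_pow_le (m w D : ℕ) : m.choose w ^ D ≤ (m * D).choose (w * D) := by
  simpa [mul_comm] using prod_choose_le (univ : Finset (Fin D)) (fun _ => m) (fun _ => w)

/-- A set meeting every row evenly is determined by all its columns but one. -/
lemma card_evenSets_column_fiber_le (t : Fin d → ℕ) (j : Fin d) :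
    #{A ∈ evenSets n d a | (fun i => #{b | (b, i) ∈ A}) = t} ≤
      ∏ i ∈ univ.erase j, n.choose (t i) := by
  let P : Fin d → Finset (Finset (Fin n)) := fun i => if i = j then {∅} else powersetCard (t i) univ
  have hP : #(Fintype.piFinset P) = ∏ i ∈ univ.erase j, n.choose (t i) := by
    rw [Fintype.card_piFinset, ← mul_prod_erase univ _ (mem_univ j)]
    simp only [P, if_true, card_singleton, one_mul]
    refine prod_congr rfl fun i hi => ?_
    rw [if_neg (ne_of_mem_erase hi), card_powersetCard, card_univ, Fintype.card_fin]
  rw [← hP]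
  refine card_le_card_of_injOn (fun A i => if i = j then ∅ else ({b | (b, i) ∈ A} : Finset (Fin n)))
    ?_ ?_
  · intro A hA
    rw [mem_coe, mem_filter] at hA
    rw [mem_coe, Fintype.mem_piFinset]
    intro i
    by_cases hi : i = j
    · simp [P, hi]
    · simp [P, hi, ← hA.2]
  · intro A hA A' hA' h
    rw [mem_coe, mem_filter, mem_evenSets] at hA hA'
    have hne : ∀ i, i ≠ j → ∀ b, (b, i) ∈ A ↔ (b, i) ∈ A' := fun i hi b => by
      have := congrFun h i
      simp only [if_neg hi] at this
      simpa using congrArg (b ∈ ·) this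
    -- The parity of a row restores its entry in the omitted column.
    have hpar : ∀ (B : Finset (Fin n × Fin d)) (b : Fin n), Even #{i | (b, i) ∈ B} →
        ((b, j) ∈ B ↔ ¬ Even #{i ∈ univ.erase j | (b, i) ∈ B}) := by
      intro B b hB
      rw [← insert_erase (mem_univ j), filter_insert] at hB
      split_ifs at hB with hj
      · rw [card_insert_of_notMem (by simp), Nat.even_add_one] at hB
        exact iff_of_true hj hB
      · exact iff_of_false hj (not_not.2 hB)
    ext ⟨b, i⟩
    by_cases hi : i = j
    · subst hi
      rw [hpar A b (hA.1.2 b), hpar A' b (hA'.1.2 b),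
        filter_congr fun k hk => hne k (ne_of_mem_erase hk) b]
    · exact hne i hi b

/-- Multiplying the bounds obtained by omitting each column in turn, every column is omitted
exactly once. This is the counting form of the entropy inequality `H(X) ≤ (d - 1) h(θ)` for a
random even-weight word `X ∈ 𝔽₂^d` with mean density `θ`. -/
lemma card_evenSets_column_fiber_pow_le (t : Fin d → ℕ) (ht : ∑ i, t i = a) :
    #{A ∈ evenSets n d a | (fun i => #{b | (b, i) ∈ A}) = t} ^ d ≤ (n * d).choose a ^ (d - 1) := by
  set F := #{A ∈ evenSets n d a | (fun i => #{b | (b, i) ∈ A}) = t}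
  calc F ^ d = ∏ _j : Fin d, F := by simp
    _ ≤ ∏ j : Fin d, ∏ i ∈ univ.erase j, n.choose (t i) :=
      prod_le_prod' fun j _ => card_evenSets_column_fiber_le t j
    _ = ∏ i : Fin d, ∏ _j ∈ univ.erase i, n.choose (t i) :=
      prod_comm' fun i j => by simp [ne_comm]
    _ = (∏ i : Fin d, n.choose (t i)) ^ (d - 1) := by simp [prod_pow]
    _ ≤ (n * d).choose a ^ (d - 1) := by
      refine Nat.pow_le_pow_left ?_ _
      simpa [ht, mul_comm] using prod_choose_le univ (fun _ : Fin d => n) t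

lemma card_evenSets_pow_le (hd : 0 < d) :
    #(evenSets n d a) ^ d ≤ ((n + 1) ^ d) ^ d * (n * d).choose a ^ (d - 1) := by
  let f : Finset (Fin n × Fin d) → Fin d → ℕ := fun A i => #{b | (b, i) ∈ A}
  let T : Finset (Fin d → ℕ) := Fintype.piFinset fun _ => range (n + 1)
  have hT : #T = (n + 1) ^ d := by simp [T]
  obtain ⟨t, -, ht⟩ := exists_max_image T (fun t => #{A ∈ evenSets n d a | f A = t})
    ⟨0, by simp [T]⟩
  have hle : #(evenSets n d a) ≤ #{A ∈ evenSets n d a | f A = t} * #T := by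
    refine card_le_mul_card_image_of_maps_to (f := f) (fun A _ => ?_) _ ht
    rw [Fintype.mem_piFinset]
    intro i
    rw [mem_range, Nat.lt_succ_iff]
    exact (card_le_univ _).trans (by simp)
  have hmax : #{A ∈ evenSets n d a | f A = t} ^ d ≤ (n * d).choose a ^ (d - 1) := by
    by_cases hs : ∑ i, t i = a
    · exact card_evenSets_column_fiber_pow_le t hs
    · rw [filter_eq_empty_iff.2, card_empty, zero_pow hd.ne']
      · exact Nat.zero_le _
      · rintro A hA rfl
        exact hs ((card_eq_sum_card_column A).symm.trans (mem_evenSets.1 hA).1)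
  calc #(evenSets n d a) ^ d ≤ (#{A ∈ evenSets n d a | f A = t} * #T) ^ d :=
        Nat.pow_le_pow_left hle _
    _ = ((n + 1) ^ d) ^ d * #{A ∈ evenSets n d a | f A = t} ^ d := by rw [mul_pow, hT, mul_comm]
    _ ≤ _ := Nat.mul_le_mul_left _ hmax

/-- When the rows have odd length, a set meeting every row evenly misses a point of each row. -/
lemma add_le_of_mem_evenSets (hd : Odd d) {A : Finset (Fin n × Fin d)} (hA : A ∈ evenSets n d a) :
    a + n ≤ n * d := by
  rw [mem_evenSets] at hA
  have h : ∑ b : Fin n, (#{i | (b, i) ∈ A} + 1) ≤ ∑ _b : Fin n, d := by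
    refine sum_le_sum fun b _ => ?_
    have h1 : #{i | (b, i) ∈ A} ≤ d := (card_le_univ _).trans (by simp)
    have h2 : #{i | (b, i) ∈ A} ≠ d := fun h =>
      (Nat.not_even_iff_odd.2 hd) (h ▸ hA.2 b)
    omega
  rw [sum_add_distrib, ← card_eq_sum_card_row, hA.1] at h
  simpa using h

lemma two_mul_card_image_fst_le {A : Finset (Fin n × Fin d)} (hA : A ∈ evenSets n d a) :
    2 * #(A.image Prod.fst) ≤ a := by
  rw [mem_evenSets] at hA
  calc 2 * #(A.image Prod.fst) = ∑ _b ∈ A.image Prod.fst, 2 := by simp [mul_comm]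
    _ ≤ ∑ b ∈ A.image Prod.fst, #{i | (b, i) ∈ A} := by
      refine sum_le_sum fun b hb => ?_
      obtain ⟨⟨b, i⟩, hi, rfl⟩ := mem_image.1 hb
      have hpos : 0 < #{k | (b, k) ∈ A} := card_pos.2 ⟨i, by simpa using hi⟩
      obtain ⟨r, hr⟩ := hA.2 b
      dsimp only
      omega
    _ ≤ ∑ b, #{i | (b, i) ∈ A} := sum_le_univ_sum_of_nonneg fun _ => Nat.zero_le _
    _ = a := by rw [← card_eq_sum_card_row, hA.1]

/-- A set meeting every row evenly is supported on at most half as many rows as it has elements;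
this is sharper than the entropy bound when `a` stays bounded as `n → ∞`. -/
lemma card_evenSets_le : #(evenSets n d a) ≤ 2 ^ (d * a) * ((a + 1) * (n + 1) ^ (a / 2)) := by
  let T : Finset (Finset (Fin n)) := (range (a / 2 + 1)).biUnion fun k => powersetCard k univ
  have hmem : ∀ B : Finset (Fin n), B ∈ T ↔ #B ≤ a / 2 := fun B => by
    simp [T]
  have hT : #T ≤ (a + 1) * (n + 1) ^ (a / 2) := by
    calc #T ≤ ∑ k ∈ range (a / 2 + 1), #(powersetCard k (univ : Finset (Fin n))) := card_biUnion_le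
      _ ≤ ∑ _k ∈ range (a / 2 + 1), (n + 1) ^ (a / 2) := by
        refine sum_le_sum fun k hk => ?_
        rw [card_powersetCard, card_univ, Fintype.card_fin]
        calc n.choose k ≤ n ^ k := Nat.choose_le_pow n k
          _ ≤ (n + 1) ^ k := Nat.pow_le_pow_left n.le_succ k
          _ ≤ (n + 1) ^ (a / 2) :=
            Nat.pow_le_pow_right n.succ_pos (Nat.lt_succ_iff.1 (mem_range.1 hk))
      _ = (a / 2 + 1) * (n + 1) ^ (a / 2) := by simp
      _ ≤ _ := Nat.mul_le_mul_right _ (by omega)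
  refine (card_le_mul_card_image_of_maps_to (f := fun A => A.image Prod.fst) (t := T)
    (fun A hA => ?_) (2 ^ (d * a)) fun B hB => ?_).trans (Nat.mul_le_mul_left _ hT)
  · have := two_mul_card_image_fst_le hA
    rw [hmem]
    omega
  · calc #{A ∈ evenSets n d a | A.image Prod.fst = B}
        ≤ #(B ×ˢ (univ : Finset (Fin d))).powerset := by
          refine card_le_card fun A hA => ?_
          rw [mem_powerset]
          intro p hp
          rw [mem_product, ← (mem_filter.1 hA).2]
          exact ⟨mem_image_of_mem _ hp, mem_univ _⟩
      _ = 2 ^ (d * #B) := by simp [mul_comm]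
      _ ≤ 2 ^ (d * a) := by
        have := (hmem B).1 hB
        exact Nat.pow_le_pow_right two_pos (Nat.mul_le_mul_left _ (by omega))

/-! ### The union bound, weight by weight -/

/-- Away from both ends, binomial coefficients exceed any prescribed power of `n`. -/
lemma pow_le_factorial_mul_choose {n M K a : ℕ} (hK : K ≤ a) (ha : a + n ≤ M) :
    (n + 1) ^ K ≤ K.factorial * M.choose a := by
  calc (n + 1) ^ K ≤ (n + 1).ascFactorial K := Nat.pow_succ_le_ascFactorial _ _
    _ = K.factorial * (n + K).choose K := Nat.ascFactorial_eq_factorial_mul_choose n K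
    _ ≤ K.factorial * M.choose a := by
      refine Nat.mul_le_mul_left _ ?_
      have h := prod_choose_le (univ : Finset (Fin 2)) ![M - (a - K), a - K] ![K, a - K]
      simp only [Fin.prod_univ_two, Fin.sum_univ_two, Matrix.cons_val_zero, Matrix.cons_val_one,
        Nat.choose_self, mul_one] at h
      rw [Nat.sub_add_cancel (by omega), Nat.add_sub_cancel' hK] at h
      exact (Nat.choose_le_choose K (by omega)).trans h

variable {m D w : ℕ}

/-- The heavy words. The bounds `C(m, w) ≤ C(nd, wD)^{1/D}` and
`#evenSets ≤ (n + 1)^d C(nd, wD)^{1 - 1/d}` leave a factor `C(nd, wD)^{1/D - 1/d}`, which beats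
every power of `n` because `d < D`. The exponent `d D (d + 2)` makes it beat both `(n + 1)^d` and
the gain `(n + 1)^2`, after everything is raised to the power `d D` to clear denominators. -/
lemma choose_mul_card_evenSets_le_of_le (hd : Odd d) (hD : d < D) (hnm : n * d = m * D)
    (hw : d * D * (d + 2) ≤ w * D) :
    m.choose w * #(evenSets n d (w * D)) * (n + 1) ^ 2 ≤
      (d * D * (d + 2)).factorial * (n * d).choose (w * D) := by
  rcases (evenSets n d (w * D)).eq_empty_or_nonempty with h0 | ⟨A, hA⟩
  · simp [h0]
  have hd0 : 0 < d := hd.pos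
  have hK := pow_le_factorial_mul_choose hw (add_le_of_mem_evenSets hd hA)
  have hm := choose_pow_le m w D
  rw [← hnm] at hm
  have he := card_evenSets_pow_le (n := n) (a := w * D) hd0
  have hC : 0 < (n * d).choose (w * D) :=
    Nat.choose_pos (by have := add_le_of_mem_evenSets hd hA; omega)
  set C := (n * d).choose (w * D)
  set F := (d * D * (d + 2)).factorial
  have hF0 : 0 < F := Nat.factorial_pos _
  set e := #(evenSets n d (w * D))
  have hdD : d * D ≠ 0 := Nat.mul_ne_zero hd0.ne' (by omega)
  clear_value C F e
  generalize n + 1 = N at hK he ⊢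
  refine le_of_pow_le_pow_left₀ hdD (Nat.zero_le _) ?_
  obtain ⟨d, rfl⟩ : ∃ k, d = k + 1 := ⟨d - 1, by omega⟩
  rw [Nat.add_sub_cancel] at he
  calc (m.choose w * e * N ^ 2) ^ ((d + 1) * D)
      = (m.choose w ^ D) ^ (d + 1) * (e ^ (d + 1)) ^ D * N ^ (2 * ((d + 1) * D)) := by ring
    _ ≤ C ^ (d + 1) * ((N ^ (d + 1)) ^ (d + 1) * C ^ d) ^ D *
        N ^ (2 * ((d + 1) * D)) := by gcongr
    _ = C ^ (d + 1 + d * D) * N ^ ((d + 1) * D * (d + 1 + 2)) := by ring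
    _ ≤ C ^ (d + 1 + d * D) * (F * C) := by gcongr
    _ = F * C ^ (d + 2 + d * D) := by ring
    _ ≤ F ^ ((d + 1) * D) * C ^ ((d + 1) * D) := by
      gcongr
      · exact Nat.le_self_pow hdD F
      · linarith
    _ = (F * C) ^ ((d + 1) * D) := by ring

/-- The light words: `C(m, w)` is at most `(n + 1)^w`, and the probability that the `wD` edges
leaving a given set of `w` checks meet every bit evenly is `O(n^{-wD/2})`. -/
lemma choose_mul_card_evenSets_le_of_lt (hd : Odd d) (hD : d < D) (hD4 : 4 ≤ D)
    (hnm : n * d = m * D) (hw0 : 0 < w) {K : ℕ} (hw : w * D ≤ K) :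
    m.choose w * #(evenSets n d (w * D)) * (n + 1) ≤
      2 ^ (d * K) * (K + 1) * K.factorial * (n * d).choose (w * D) := by
  rcases (evenSets n d (w * D)).eq_empty_or_nonempty with h0 | ⟨A, hA⟩
  · simp [h0]
  have hC := pow_le_factorial_mul_choose le_rfl (add_le_of_mem_evenSets hd hA)
  have he := card_evenSets_le (n := n) (d := d) (a := w * D)
  have hmn : m ≤ n := by
    by_contra! h
    have h1 : n * d ≤ n * D := Nat.mul_le_mul_left _ hD.le
    have h2 : n * D < m * D := Nat.mul_lt_mul_of_pos_right h (by omega)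
    omega
  have hm : m.choose w ≤ (n + 1) ^ w :=
    (Nat.choose_le_pow m w).trans (Nat.pow_le_pow_left (by omega) w)
  have h4 : w * 4 ≤ w * D := Nat.mul_le_mul_left _ hD4
  set a := w * D
  calc m.choose w * #(evenSets n d a) * (n + 1)
      ≤ (n + 1) ^ w * (2 ^ (d * a) * ((a + 1) * (n + 1) ^ (a / 2))) * (n + 1) := by gcongr
    _ = 2 ^ (d * a) * (a + 1) * (n + 1) ^ (w + a / 2 + 1) := by ring
    _ ≤ 2 ^ (d * a) * (a + 1) * (n + 1) ^ a := by
      gcongr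
      · omega
      · omega
    _ ≤ 2 ^ (d * a) * (a + 1) * (a.factorial * (n * d).choose a) := by gcongr
    _ ≤ 2 ^ (d * K) * (K + 1) * (K.factorial * (n * d).choose a) := by
      gcongr
      · norm_num
    _ = _ := by ring

end EvenSets

/-! ### Random matchings of sockets -/

section RandomMatching

open Finset

/-- Under a uniformly random bijection, the preimage of a fixed set is a uniformly random set of
the same size. -/
lemma card_equiv_preimage_mem_mul_choose {α β : Type} [Fintype α] [Fintype β] [DecidableEq α]
    [DecidableEq β] (B : Finset β) {F : Finset (Finset α)} (hF : F ⊆ powersetCard #B univ) :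
    #{G : α ≃ β | B.map G.symm.toEmbedding ∈ F} * (Fintype.card α).choose #B =
      #F * Fintype.card (α ≃ β) := by
  let N : Finset α → ℕ := fun A => #{G : α ≃ β | B.map G.symm.toEmbedding = A}
  have hN : ∀ F' : Finset (Finset α),
      #{G : α ≃ β | B.map G.symm.toEmbedding ∈ F'} = ∑ A ∈ F', N A := fun F' => by
    rw [card_eq_sum_card_fiberwise (f := fun G : α ≃ β => B.map G.symm.toEmbedding) (t := F')]
    · refine sum_congr rfl fun A hA => congrArg card ?_
      ext G
      simp only [mem_filter, mem_univ, true_and]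
      exact ⟨fun h => h.2, fun h => ⟨h ▸ hA, h⟩⟩
    · intro G hG
      simpa using hG
  have hconst : ∀ A ∈ powersetCard #B univ, ∀ A' ∈ powersetCard #B univ, N A ≤ N A' := by
    intro A hA A' hA'
    have hcard : #A' = #A := (mem_powersetCard.1 hA').2.trans (mem_powersetCard.1 hA).2.symm
    let e : {x // x ∈ A'} ≃ {x // x ∈ A} := equivOfCardEq hcard
    let σ : Equiv.Perm α := e.extendSubtype
    refine card_le_card_of_injOn (fun G => σ.trans G) (fun G hG => ?_) fun G _ G' _ h => ?_
    · rw [mem_coe, mem_filter] at hG ⊢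
      refine ⟨mem_univ _, ?_⟩
      refine eq_of_subset_of_card_le (fun x hx => ?_) ?_
      · obtain ⟨b, hb, rfl⟩ := mem_map.1 hx
        have hbA : G.symm b ∈ A := hG.2 ▸ mem_map_of_mem G.symm.toEmbedding hb
        by_contra hx'
        have hx'' := e.extendSubtype_not_mem _ hx'
        simp [σ] at hx''
        exact hx'' hbA
      · rw [card_map, (mem_powersetCard.1 hA').2]
    · ext x
      simpa using congrArg (fun g : α ≃ β => g (σ.symm x)) h
  have htotal : Fintype.card (α ≃ β) = ∑ A ∈ powersetCard #B univ, N A := by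
    rw [← hN, filter_true_of_mem, card_univ]
    intro G _
    simp [mem_powersetCard]
  calc _ = ∑ A ∈ F, ∑ _A' ∈ powersetCard #B (univ : Finset α), N A := by
        rw [hN, sum_mul]
        simp [mul_comm]
    _ = ∑ A ∈ F, ∑ A' ∈ powersetCard #B (univ : Finset α), N A' :=
        sum_congr rfl fun A hA => sum_congr rfl fun A' hA' =>
          le_antisymm (hconst A (hF hA) A' hA') (hconst A' hA' A (hF hA))
    _ = _ := by rw [← htotal, sum_const, smul_eq_mul]

variable {ΔB ΔC n m : ℕ}

/-- The bit sockets matched to the sockets of the checks in `S`. -/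
def TannerGraph.socketsOf (G : TannerGraph ΔB ΔC n m) (S : Finset (Fin m)) :
    Finset (Fin n × Fin ΔB) :=
  (S ×ˢ univ).map G.symm.toEmbedding

lemma TannerGraph.mem_socketsOf {G : TannerGraph ΔB ΔC n m} {S : Finset (Fin m)}
    {p : Fin n × Fin ΔB} : p ∈ G.socketsOf S ↔ (G p).1 ∈ S := by
  rw [socketsOf, mem_map]
  constructor
  · rintro ⟨q, hq, rfl⟩
    simpa using hq
  · exact fun h => ⟨G p, by simpa using h, by simp⟩

lemma TannerGraph.card_socketsOf (G : TannerGraph ΔB ΔC n m) (S : Finset (Fin m)) :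
    #(G.socketsOf S) = #S * ΔC := by
  simp [socketsOf]

/-- A linear dependency among the rows of the parity-check matrix is a nonempty set of checks
that every bit joins by an even number of edges. -/
lemma TannerGraph.exists_socketsOf_mem_evenSets {G : TannerGraph ΔB ΔC n m}
    (hG : ¬ LinearIndependent (ZMod 2) G.parityCheck.row) :
    ∃ S : Finset (Fin m), S.Nonempty ∧ G.socketsOf S ∈ evenSets n ΔB (#S * ΔC) := by
  rw [linearIndependent_row_iff_vecMul] at hG
  push Not at hG
  obtain ⟨x, hx, hx0⟩ := hG
  obtain ⟨c, hc⟩ := Function.ne_iff.1 hx0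
  refine ⟨univ.filter fun c => x c = 1, ⟨c, ?_⟩, mem_evenSets.2 ⟨G.card_socketsOf _, fun b => ?_⟩⟩
  · simpa using (x c).two_eq_zero_or_eq_one.resolve_left hc
  · rw [← ZMod.natCast_eq_zero_iff_even]
    have hb : Matrix.vecMul x G.parityCheck b = 0 := congrFun hx b
    rw [← hb, card_eq_sum_card_fiberwise (f := fun i => (G (b, i)).1)
      (t := univ.filter fun c => x c = 1)]
    · rw [Matrix.vecMul, dotProduct, Nat.cast_sum, sum_filter]
      refine sum_congr rfl fun c _ => ?_
      split_ifs with h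
      · rw [h, one_mul, TannerGraph.parityCheck, Matrix.of_apply]
        congr 2
        ext i
        simp only [mem_filter, mem_univ, true_and, TannerGraph.mem_socketsOf]
        exact ⟨fun hi => hi.2, fun hi => ⟨hi ▸ h, hi⟩⟩
      · rw [(x c).two_eq_zero_or_eq_one.resolve_right h, zero_mul]
    · intro i hi
      simpa [TannerGraph.mem_socketsOf] using hi

open Classical in
/-- The union bound over all candidate dependencies, grouped by their weight `w`. -/
lemma card_not_linearIndependent_le :
    (#{G : TannerGraph ΔB ΔC n m | ¬ LinearIndependent (ZMod 2) G.parityCheck.row} : ℝ) ≤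
      (∑ w ∈ Ico 1 (m + 1), (m.choose w * #(evenSets n ΔB (w * ΔC)) : ℝ) /
        (n * ΔB).choose (w * ΔC)) * Fintype.card (TannerGraph ΔB ΔC n m) := by
  rcases isEmpty_or_nonempty (TannerGraph ΔB ΔC n m) with hE | ⟨⟨G₀⟩⟩
  · simp
  let p : ℕ → ℝ := fun w => if w = 0 then 0 else
    (#(evenSets n ΔB (w * ΔC)) : ℝ) / (n * ΔB).choose (w * ΔC) *
      Fintype.card (TannerGraph ΔB ΔC n m)
  have hS : ∀ S : Finset (Fin m), S.Nonempty →
      (#{G : TannerGraph ΔB ΔC n m | G.socketsOf S ∈ evenSets n ΔB (#S * ΔC)} : ℝ) = p #S := by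
    intro S hS
    have hB : #(S ×ˢ (univ : Finset (Fin ΔC))) = #S * ΔC := by simp
    have h := card_equiv_preimage_mem_mul_choose (α := Fin n × Fin ΔB)
      (S ×ˢ (univ : Finset (Fin ΔC))) (F := evenSets n ΔB (#S * ΔC)) (by rw [hB]; exact filter_subset _ _)
    have hle : #S * ΔC ≤ n * ΔB := by
      rw [← G₀.card_socketsOf S]
      exact (card_le_univ _).trans (by simp)
    have hC : ((n * ΔB).choose (#S * ΔC) : ℝ) ≠ 0 := by
      exact_mod_cast (Nat.choose_pos hle).ne'
    rw [hB, Fintype.card_prod, Fintype.card_fin, Fintype.card_fin] at h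
    simp only [p, hS.card_ne_zero, if_false]
    rw [div_mul_eq_mul_div, eq_div_iff hC]
    exact_mod_cast h
  have hsub : (univ.filter fun G : TannerGraph ΔB ΔC n m =>
        ¬ LinearIndependent (ZMod 2) G.parityCheck.row) ⊆
      (univ.filter Finset.Nonempty).biUnion fun S : Finset (Fin m) =>
        univ.filter fun G : TannerGraph ΔB ΔC n m =>
          G.socketsOf S ∈ evenSets n ΔB (#S * ΔC) := by
    intro G hG
    obtain ⟨S, hS, hGS⟩ := TannerGraph.exists_socketsOf_mem_evenSets (mem_filter.1 hG).2
    exact mem_biUnion.2 ⟨S, by simpa using hS, by simpa using hGS⟩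
  calc _ ≤ ((∑ S ∈ univ.filter Finset.Nonempty, #{G : TannerGraph ΔB ΔC n m |
        G.socketsOf S ∈ evenSets n ΔB (#S * ΔC)} : ℕ) : ℝ) := by
        exact_mod_cast (card_le_card hsub).trans card_biUnion_le
    _ = ∑ S ∈ univ.filter (Finset.Nonempty (α := Fin m)), p #S := by
        rw [Nat.cast_sum]
        exact sum_congr rfl fun S hS' => hS S (mem_filter.1 hS').2
    _ = ∑ S ∈ (univ : Finset (Fin m)).powerset, p #S := by
        rw [powerset_univ, sum_filter_of_ne]
        intro S _ hne
        by_contra h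
        rw [not_nonempty_iff_eq_empty] at h
        simp [p, h] at hne
    _ = ∑ w ∈ range (m + 1), m.choose w • p w := by
        rw [sum_powerset_apply_card, card_univ, Fintype.card_fin]
    _ = ∑ w ∈ Ico 1 (m + 1), m.choose w • p w := by
        rw [range_eq_Ico, sum_eq_sum_Ico_succ_bot m.succ_pos]
        simp [p]
    _ = _ := by
        rw [sum_mul]
        refine sum_congr rfl fun w hw => ?_
        have : w ≠ 0 := by have := (mem_Ico.1 hw).1; omega
        simp only [p, this, if_false, nsmul_eq_mul]
        ring

/-- The expected number of dependencies among the checks is `O(1 / n)`: boundedly many light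
weights contribute `O(1 / n)` each, and the heavy ones, at most `n` in number, `O(1 / n²)` each. -/
lemma exists_sum_choose_mul_card_evenSets_le (hd : Odd ΔB) (hB : 2 ≤ ΔB) (hBC : ΔB < ΔC) :
    ∃ L : ℕ, ∀ n m : ℕ, n * ΔB = m * ΔC →
      ∑ w ∈ Ico 1 (m + 1), (m.choose w * #(evenSets n ΔB (w * ΔC)) : ℝ) /
        (n * ΔB).choose (w * ΔC) ≤ L / (n + 1) := by
  have hC4 : 4 ≤ ΔC := by
    obtain ⟨r, hr⟩ := hd
    omega
  set K := ΔB * ΔC * (ΔB + 2)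
  set L := 2 ^ (ΔB * K) * (K + 1) * K.factorial
  have hKL : K.factorial ≤ L := Nat.le_mul_of_pos_left _ (by positivity)
  refine ⟨(K + 1) * L, fun n m hnm => ?_⟩
  have hmn : m ≤ n := by
    by_contra! h
    have h1 : n * ΔB ≤ n * ΔC := Nat.mul_le_mul_left _ hBC.le
    have h2 : n * ΔC < m * ΔC := Nat.mul_lt_mul_of_pos_right h (by omega)
    omega
  have hn : (0 : ℝ) < n + 1 := by positivity
  have hterm : ∀ w ∈ Ico 1 (m + 1), (m.choose w * #(evenSets n ΔB (w * ΔC)) : ℝ) /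
      (n * ΔB).choose (w * ΔC) ≤ (if w < K then (L : ℝ) / (n + 1) else 0) + L / (n + 1) ^ 2 := by
    intro w hw
    rw [mem_Ico] at hw
    have hC : (0 : ℝ) < (n * ΔB).choose (w * ΔC) := by
      rw [hnm]
      exact_mod_cast Nat.choose_pos (Nat.mul_le_mul_right _ (Nat.lt_succ_iff.1 hw.2))
    rcases lt_or_ge (w * ΔC) K with h | h
    -- `w ΔC < K` is the range of light words, of which there are fewer than `K`.
    · have hwK : w < K := (Nat.le_mul_of_pos_right w (by omega)).trans_lt h
      rw [if_pos hwK]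
      refine le_add_of_le_of_nonneg ?_ (by positivity)
      rw [div_le_div_iff₀ hC hn]
      exact_mod_cast choose_mul_card_evenSets_le_of_lt hd hBC hC4 hnm hw.1 h.le
    · refine le_add_of_nonneg_of_le (by split_ifs <;> positivity) ?_
      rw [div_le_div_iff₀ hC (by positivity)]
      have := (choose_mul_card_evenSets_le_of_le hd hBC hnm h).trans (Nat.mul_le_mul_right _ hKL)
      exact_mod_cast this
  refine (sum_le_sum hterm).trans ?_
  rw [sum_add_distrib]
  have h1 : ∑ w ∈ Ico 1 (m + 1), (if w < K then (L : ℝ) / (n + 1) else 0) ≤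
      K * (L / (n + 1)) := by
    rw [← sum_filter, sum_const, nsmul_eq_mul]
    refine mul_le_mul_of_nonneg_right ?_ (by positivity)
    have : #{w ∈ Ico 1 (m + 1) | w < K} ≤ #(range K) :=
      card_le_card fun w hw => mem_range.2 (mem_filter.1 hw).2
    rw [card_range] at this
    exact_mod_cast this
  have h2 : ∑ _w ∈ Ico 1 (m + 1), (L : ℝ) / ((n : ℝ) + 1) ^ 2 ≤ (L : ℝ) / (n + 1) := by
    rw [sum_const, Nat.card_Ico, nsmul_eq_mul, Nat.add_sub_cancel, sq, ← div_div,
      mul_div_assoc', div_le_iff₀ hn, mul_comm]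
    refine mul_le_mul_of_nonneg_left ?_ (by positivity)
    exact_mod_cast hmn.trans n.le_succ
  refine (add_le_add h1 h2).trans (le_of_eq ?_)
  push_cast
  ring

/-- The checks are independent with high probability. For even `ΔB` this fails, because the sum of
all checks vanishes. Positivity of `n` is recorded because the free energy density of a code
without qubits is a junk value. -/
theorem withHighProbability_linearIndependent (hB : 2 ≤ ΔB) (hBC : ΔB < ΔC) (hd : Odd ΔB) :
    WithHighProbability ΔB ΔC fun n _ G =>
      0 < n ∧ LinearIndependent (ZMod 2) G.parityCheck.row := by
  classical
  obtain ⟨L, hL⟩ := exists_sum_choose_mul_card_evenSets_le hd hB hBC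
  intro ε hε
  obtain ⟨N, hN⟩ := exists_nat_ge ((L : ℝ) / ε)
  refine ⟨N + 1, fun n m hn hnm => ?_⟩
  have hne : Nonempty (TannerGraph ΔB ΔC n m) := by
    rw [← Fintype.card_eq]
    simpa using hnm
  have hpos : (0 : ℝ) < Fintype.card (TannerGraph ΔB ΔC n m) := by
    exact_mod_cast Fintype.card_pos
  have hbad := (card_not_linearIndependent_le (ΔB := ΔB) (ΔC := ΔC) (n := n) (m := m)).trans
    (mul_le_mul_of_nonneg_right (hL n m hnm) hpos.le)
  have hε' : (L : ℝ) / (n + 1) ≤ ε := by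
    rw [div_le_iff₀ hε] at hN
    rw [div_le_iff₀ (by positivity)]
    have : (N : ℝ) ≤ n + 1 := by exact_mod_cast (by omega : N ≤ n + 1)
    nlinarith
  have hcompl := card_filter_add_card_filter_not (s := univ)
    fun G : TannerGraph ΔB ΔC n m => LinearIndependent (ZMod 2) G.parityCheck.row
  have hgood : Nat.card {G : TannerGraph ΔB ΔC n m |
      0 < n ∧ LinearIndependent (ZMod 2) G.parityCheck.row} =
      #{G : TannerGraph ΔB ΔC n m | LinearIndependent (ZMod 2) G.parityCheck.row} := by
    have hn0 : 0 < n := by omega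
    simp only [hn0, true_and]
    exact Nat.subtype_card _ (by simp)
  rw [ensembleProb, hgood, Nat.card_eq_fintype_card, le_div_iff₀ hpos]
  rw [card_univ] at hcompl
  have hcompl' : (#{G : TannerGraph ΔB ΔC n m | LinearIndependent (ZMod 2) G.parityCheck.row} : ℝ) +
      #{G : TannerGraph ΔB ΔC n m | ¬ LinearIndependent (ZMod 2) G.parityCheck.row} =
      Fintype.card (TannerGraph ΔB ΔC n m) := by exact_mod_cast hcompl
  nlinarith [mul_le_mul_of_nonneg_right hε' hpos.le]

lemma WithHighProbability.mono {E E' : ∀ n m : ℕ, TannerGraph ΔB ΔC n m → Prop}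
    (h : WithHighProbability ΔB ΔC E)
    (hE : ∀ n m, n * ΔB = m * ΔC → ∀ G : TannerGraph ΔB ΔC n m, E n m G → E' n m G) :
    WithHighProbability ΔB ΔC E' := by
  intro ε hε
  obtain ⟨n₀, hn₀⟩ := h ε hε
  refine ⟨n₀, fun n m hn hnm => (hn₀ n m hn hnm).trans ?_⟩
  refine div_le_div_of_nonneg_right ?_ (Nat.cast_nonneg _)
  exact_mod_cast Nat.card_mono (Set.toFinite _) fun G hG => hE n m hnm G hG

end RandomMatching

/-! ### The thermodynamic limit -/

lemma analyticOnNhd_freeEnergy (r : ℝ) :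
    AnalyticOnNhd ℝ (fun β => -((Real.log 2 + r * Real.log (Real.cosh β)) / β)) (Set.Ioi 0) := by
  intro β hβ
  have hcosh : AnalyticAt ℝ Real.cosh β := Real.analyticAt_cosh
  exact ((analyticAt_const.add (analyticAt_const.mul (hcosh.log (Real.cosh_pos β)))).div
    analyticAt_id (ne_of_gt hβ)).neg

theorem mainTheorem2 (ΔB ΔC : ℕ) (hB : 2 ≤ ΔB) (hBC : ΔB < ΔC) (hodd : Odd ΔB) :
    (WithHighProbability ΔB ΔC fun n _ G =>
      ∀ β : ℝ, (hypergraphProduct G.parityCheck).partitionFunction β =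
        (2 : ℂ) ^ (logicalBits G.parityCheck ^ 2) *
          ((2 * Real.cosh β : ℝ) : ℂ) ^ (2 * n * (n - logicalBits G.parityCheck))) ∧
    NoThermodynamicPhaseTransition ΔB ΔC := by
  have hG := withHighProbability_linearIndependent hB hBC hodd
  refine ⟨hG.mono fun n m _ G h β => partitionFunction_hypergraphProduct_eq_logicalBits h.2 β,
    _, analyticOnNhd_freeEnergy (2 * ΔB * ΔC / (ΔB ^ 2 + ΔC ^ 2)), fun ε hε =>
      hG.mono fun n m hnm G h β _ => ?_⟩
  rw [freeEnergyDensity_hypergraphProduct h.2 h.1 (by omega) hnm, sub_self, abs_zero]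
  exact hε
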